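/- Let $P_L(v,z)\in\mathbb{Z}[v^{\pm1},z^{\pm1}]$ be the Homflypt polynomial of oriented links $L$, i.e. the unique invariant of oriented links that equals $1$ on the trivial knot and satisfies $P_{D_+} = v z\,P_{D_0} + v^2\,P_{D_-}$ for diagrams $D_+, D_0, D_-$ that differ only at one crossing, which is positive, smoothed, and negative, respectively. Let $\nabla_L(z) = P_L(1,z)$ be the Conway polynomial. Let $\beta\in B_3$ be a braid on three strands in the Artin generators $\sigma_1,\sigma_2$ (positive crossings), let $w\in\mathbb{Z}$ be its exponent sum (writhe), and let $\widehat\beta$ be its closure. Then $$P_{\widehat\beta} \;=\; P_{T_w}\,P_{O_2} \;-\; \nabla_{\widehat\beta}\; v^{w}\,\bigl(P_{O_3}-1\bigr),$$ where $T_w$ is the closure of the two-strand braid $\sigma_1^{\,w}$ (the elementary torus link with two strands and $w$ crossings counted with sign), and $O_n$ is the trivial link with $n$ components. -/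

import Mathlib

open scoped LaurentPolynomial

noncomputable section

namespace BraidLink

/-! ### Braid groups -/

/-- Labels of the Artin generators of the braid group on `n` strands. The label `i` stands for the
crossing of the strands in positions `i` and `i + 1`, positions being counted from `0`. -/
abbrev Gen (n : ℕ) : Type := {i : ℕ // i + 1 < n}

/-- The Artin relators: far commutativity and the braid relation. -/
def rels (n : ℕ) : Set (FreeGroup (Gen n)) :=
  {r | (∃ i j : Gen n, i.1 + 1 < j.1 ∧
          r = FreeGroup.of i * FreeGroup.of j * (FreeGroup.of j * FreeGroup.of i)⁻¹) ∨
       (∃ i j : Gen n, i.1 + 1 = j.1 ∧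
          r = FreeGroup.of i * FreeGroup.of j * FreeGroup.of i *
            (FreeGroup.of j * FreeGroup.of i * FreeGroup.of j)⁻¹)}

/-- The Artin braid group `B_n` on `n` strands. -/
abbrev BraidGroup (n : ℕ) : Type := PresentedGroup (rels n)

/-- The Artin generator crossing positions `i` and `i + 1` (a positive crossing). -/
def σ {n : ℕ} (i : ℕ) (h : i + 1 < n) : BraidGroup n := PresentedGroup.of ⟨i, h⟩

theorem σ_comm {n : ℕ} {i j : ℕ} (hi : i + 1 < n) (hj : j + 1 < n) (hij : i + 1 < j) :
    σ i hi * σ j hj = σ j hj * σ i hi := by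
  have := PresentedGroup.one_of_mem (rels := rels n)
    (x := FreeGroup.of (⟨i, hi⟩ : Gen n) * FreeGroup.of ⟨j, hj⟩ *
      (FreeGroup.of ⟨j, hj⟩ * FreeGroup.of ⟨i, hi⟩)⁻¹) (Or.inl ⟨_, _, hij, rfl⟩)
  rw [map_mul, map_inv, mul_inv_eq_one] at this
  simp only [map_mul] at this
  exact this

theorem σ_braid {n : ℕ} {i : ℕ} (hi : i + 1 < n) (hj : i + 1 + 1 < n) :
    σ i hi * σ (i + 1) hj * σ i hi = σ (i + 1) hj * σ i hi * σ (i + 1) hj := by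
  have := PresentedGroup.one_of_mem (rels := rels n)
    (x := FreeGroup.of (⟨i, hi⟩ : Gen n) * FreeGroup.of ⟨i + 1, hj⟩ * FreeGroup.of ⟨i, hi⟩ *
      (FreeGroup.of ⟨i + 1, hj⟩ * FreeGroup.of ⟨i, hi⟩ * FreeGroup.of ⟨i + 1, hj⟩)⁻¹)
    (Or.inr ⟨_, _, rfl, rfl⟩)
  rw [map_mul, map_inv, mul_inv_eq_one] at this
  simp only [map_mul] at this
  exact this

/-- A map on the Artin generators that respects the Artin relations extends to `B_n`. -/
def liftHom {n : ℕ} {G : Type*} [Group G] (g : Gen n → G)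
    (hc : ∀ i j : Gen n, i.1 + 1 < j.1 → g i * g j = g j * g i)
    (hb : ∀ i j : Gen n, i.1 + 1 = j.1 → g i * g j * g i = g j * g i * g j) :
    BraidGroup n →* G :=
  PresentedGroup.toGroup (f := g) (by
    rintro r (⟨i, j, h, rfl⟩ | ⟨i, j, h, rfl⟩)
    · simp only [map_mul, map_inv, FreeGroup.lift_apply_of]
      rw [hc i j h, mul_inv_cancel]
    · simp only [map_mul, map_inv, FreeGroup.lift_apply_of]
      rw [hb i j h, mul_inv_cancel])

theorem liftHom_σ {n : ℕ} {G : Type*} [Group G] (g : Gen n → G) (hc hb) (i : ℕ)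
    (h : i + 1 < n) : liftHom g hc hb (σ i h) = g ⟨i, h⟩ :=
  PresentedGroup.toGroup.of _

/-- The exponent sum of a braid. -/
def writheHom (n : ℕ) : BraidGroup n →* Multiplicative ℤ :=
  liftHom (fun _ => Multiplicative.ofAdd 1) (fun _ _ _ => rfl) (fun _ _ _ => rfl)

/-- The writhe `w(β)`: the exponent sum of any braid word for `β`. -/
def writhe {n : ℕ} (β : BraidGroup n) : ℤ := Multiplicative.toAdd (writheHom n β)

/-- The inclusion `B_n → B_{n+1}` that adds one strand, in the last position. -/
def addStrand (n : ℕ) : BraidGroup n →* BraidGroup (n + 1) :=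
  liftHom (fun i => σ i.1 (Nat.lt_succ_of_lt i.2))
    (fun _ _ h => σ_comm _ _ h)
    (by
      rintro ⟨i, hi⟩ ⟨j, hj⟩ h
      obtain rfl : i + 1 = j := h
      exact σ_braid _ _)

theorem addStrand_σ {n : ℕ} (i : ℕ) (h : i + 1 < n) :
    addStrand n (σ i h) = σ i (Nat.lt_succ_of_lt h) := liftHom_σ _ _ _ i h

theorem writhe_mul {n : ℕ} (α β : BraidGroup n) : writhe (α * β) = writhe α + writhe β := by
  simp [writhe]

theorem writhe_inv {n : ℕ} (α : BraidGroup n) : writhe α⁻¹ = - writhe α := by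
  simp [writhe]

theorem writhe_one {n : ℕ} : writhe (1 : BraidGroup n) = 0 := by
  simp [writhe]

theorem writhe_σ {n : ℕ} (i : ℕ) (h : i + 1 < n) : writhe (σ i h) = 1 := by
  simp [writhe, writheHom, liftHom_σ]

theorem braid_induction {n : ℕ} {C : BraidGroup n → Prop} (one : C 1)
    (mul : ∀ x i h, C x → C (x * σ i h)) (mul_inv : ∀ x i h, C x → C (x * (σ i h)⁻¹))
    (β : BraidGroup n) : C β := by
  have key : ∀ y ∈ Subgroup.closure (Set.range (PresentedGroup.of (rels := rels n))), C y := by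
    intro y hy
    induction hy using Subgroup.closure_induction_right with
    | one => exact one
    | mul_right x hx y hy ih =>
      obtain ⟨⟨i, h⟩, rfl⟩ := hy
      exact mul x i h ih
    | mul_inv_cancel x hx y hy ih =>
      obtain ⟨⟨i, h⟩, rfl⟩ := hy
      exact mul_inv x i h ih
  exact key β (by rw [PresentedGroup.closure_range_of]; trivial)

theorem writhe_addStrand {n : ℕ} (β : BraidGroup n) : writhe (addStrand n β) = writhe β := by
  induction β using braid_induction with
  | one => simp [writhe_one]
  | mul x i h ih => simp [writhe_mul, ih, addStrand_σ, writhe_σ]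
  | mul_inv x i h ih => simp [writhe_mul, writhe_inv, ih, addStrand_σ, writhe_σ]

/-! ### Oriented links

By the theorems of Alexander and Markov, closing braids identifies the oriented link types in
three-space (nonempty, up to isotopy) with the classes of braids on at least one strand under
conjugation and positive and negative stabilization. -/

/-- A braid on `m + 1 ≥ 1` strands. -/
abbrev SomeBraid : Type := Σ m : ℕ, BraidGroup (m + 1)

/-- The Markov moves. -/
inductive MarkovMove : SomeBraid → SomeBraid → Prop
  | conj {m : ℕ} (α β : BraidGroup (m + 1)) : MarkovMove ⟨m, β⟩ ⟨m, α * β * α⁻¹⟩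
  | stab {m : ℕ} (β : BraidGroup (m + 1)) :
      MarkovMove ⟨m, β⟩ ⟨m + 1, addStrand (m + 1) β * σ m (Nat.lt_succ_self _)⟩
  | stabNeg {m : ℕ} (β : BraidGroup (m + 1)) :
      MarkovMove ⟨m, β⟩ ⟨m + 1, addStrand (m + 1) β * (σ m (Nat.lt_succ_self _))⁻¹⟩

/-- Nonempty oriented link types, as braids up to the equivalence generated by the Markov moves. -/
def OrientedLink : Type := Quot MarkovMove

/-- The closure `β̂` of a braid. -/
def braidClosure {m : ℕ} (β : BraidGroup (m + 1)) : OrientedLink := Quot.mk _ ⟨m, β⟩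

/-- The trivial link `O_n` with `n ≥ 1` components. -/
def unlink : (n : ℕ) → [NeZero n] → OrientedLink
  | 0, h => (h.out rfl).elim
  | m + 1, _ => braidClosure (1 : BraidGroup (m + 1))

/-- The elementary torus link `T_p = K(p, 2)`, for any integer `p`: the closure of the
two-strand braid with `p` crossings. -/
def torusLink (p : ℤ) : OrientedLink := braidClosure (m := 1) (σ 0 Nat.one_lt_two ^ p)

/-! ### The Homflypt polynomial -/

/-- The ring `ℤ[v^{±1}, z^{±1}]`, as Laurent polynomials in `v` over Laurent polynomials in `z`. -/
abbrev LaurentVZ : Type := ℤ[T;T⁻¹][T;T⁻¹]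

/-- The power `v^k` for an integer `k`. -/
def vpow (k : ℤ) : LaurentVZ := LaurentPolynomial.T k

/-- The variable `z`. -/
def zvar : LaurentVZ := LaurentPolynomial.C (LaurentPolynomial.T 1)

/-- `P` is the Homflypt polynomial: an invariant of oriented links with value `1` on the trivial
knot and `P(D₊) = v z P(D₀) + v² P(D₋)` for every skein triple. Every skein triple is presented by
braids `β σ_i`, `β`, `β σ_i⁻¹`. -/
structure IsHomflypt (P : OrientedLink → LaurentVZ) : Prop where
  unknot : P (unlink 1) = 1
  skein : ∀ {m : ℕ} (β : BraidGroup (m + 1)) (i : ℕ) (h : i + 1 < m + 1),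
    P (braidClosure (β * σ i h)) =
      vpow 1 * zvar * P (braidClosure β) + vpow 2 * P (braidClosure (β * (σ i h)⁻¹))

/-! ### Existence and uniqueness of the Homflypt polynomial

Existence: the vertex models with `N` spins and real parameter `q > 1` give functions on braids for
`v = q⁻ᴺ` and `z = q - q⁻¹`; the skein relation shows that their values come from one Laurent
polynomial in `v` and `z`. This part serves only to define `homflypt` below. -/

/-- Functions on braids that behave as the Homflypt polynomial, with values in any ring. -/
structure IsHomfly {A : Type} [CommRing A] (v z : A)
    (f : (m : ℕ) → BraidGroup (m + 1) → A) : Prop where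
  one : f 0 1 = 1
  comm : ∀ {m} (α β : BraidGroup (m + 1)), f m (α * β) = f m (β * α)
  stab : ∀ {m} (β : BraidGroup (m + 1)),
    f (m + 1) (addStrand (m + 1) β * σ m (Nat.lt_succ_self _)) = f m β
  stabNeg : ∀ {m} (β : BraidGroup (m + 1)),
    f (m + 1) (addStrand (m + 1) β * (σ m (Nat.lt_succ_self _))⁻¹) = f m β
  skein : ∀ {m} (β : BraidGroup (m + 1)) (i : ℕ) (h : i + 1 < m + 1),
    f m (β * σ i h) = v * z * f m β + v ^ 2 * f m (β * (σ i h)⁻¹)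

section Reduction

variable {R A : Type} [CommRing R] [CommRing A] [Algebra R A]

/-- Functions on `B_n` that satisfy the skein relation in any place. -/
def IsSkein (v z : R) {n : ℕ} (f : BraidGroup n → A) : Prop :=
  ∀ (a b : BraidGroup n) (i : ℕ) (h : i + 1 < n),
    f (a * σ i h * b) = (v * z) • f (a * b) + (v ^ 2) • f (a * (σ i h)⁻¹ * b)

theorem IsSkein.addStrand {v z : R} {n : ℕ} {f : BraidGroup (n + 1) → A} (hf : IsSkein v z f)
    (x y : BraidGroup (n + 1)) :
    IsSkein v z (fun c : BraidGroup n => f (x * addStrand n c * y)) := by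
  intro a b i h
  have := hf (x * BraidLink.addStrand n a) (BraidLink.addStrand n b * y) i (Nat.lt_succ_of_lt h)
  simpa [addStrand_σ, mul_assoc] using this

theorem IsSkein.mul_right {v z : R} {n : ℕ} {f : BraidGroup n → A} (hf : IsSkein v z f)
    (y : BraidGroup n) : IsSkein v z (fun c => f (c * y)) := by
  intro a b i h
  have := hf a (b * y) i h
  simpa [mul_assoc] using this

theorem IsSkein.inv_mem {v z : R} (hv : IsUnit v) {n : ℕ} {f : BraidGroup n → A}
    (hf : IsSkein v z f) (S : Submodule R A) (a b : BraidGroup n) (i : ℕ) (h : i + 1 < n)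
    (h0 : f (a * b) ∈ S) (h1 : f (a * σ i h * b) ∈ S) : f (a * (σ i h)⁻¹ * b) ∈ S := by
  have key := hf a b i h
  have h2 : (v ^ 2) • f (a * (σ i h)⁻¹ * b) ∈ S := by
    have : (v ^ 2) • f (a * (σ i h)⁻¹ * b) = f (a * σ i h * b) - (v * z) • f (a * b) := by
      rw [key]; abel
    rw [this]
    exact S.sub_mem h1 (S.smul_mem _ h0)
  exact (Submodule.smul_mem_iff_of_isUnit S (hv.pow 2)).1 h2

theorem σ_comm_addStrand {n : ℕ} (c : BraidGroup n) :
    Commute (σ n (Nat.lt_succ_self _)) (addStrand (n + 1) (addStrand n c)) := by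
  induction c using braid_induction with
  | one => simp
  | mul x i h ih =>
    simp only [map_mul, addStrand_σ]
    exact ih.mul_right (σ_comm _ _ h).symm
  | mul_inv x i h ih =>
    simp only [map_mul, map_inv, addStrand_σ]
    exact ih.mul_right (Commute.inv_right (σ_comm _ _ h).symm)

theorem braidGroup_one (β : BraidGroup 1) : β = 1 := by
  induction β using braid_induction with
  | one => rfl
  | mul x i h ih => omega
  | mul_inv x i h ih => omega

/-- Modulo the skein relation, `B_{n+1}` is spanned by braids that use the last generator at most
once. -/
theorem skein_span {v z : R} (hv : IsUnit v) (S : Submodule R A) (n : ℕ) :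
    ∀ (f : BraidGroup (n + 2) → A), IsSkein v z f →
      (∀ a : BraidGroup (n + 1), f (addStrand _ a) ∈ S) →
      (∀ a b : BraidGroup (n + 1),
        f (addStrand _ a * σ n (Nat.lt_succ_self _) * addStrand _ b) ∈ S) →
      ∀ β, f β ∈ S := by
  induction n with
  | zero =>
    intro f hf h0 h1 β
    induction β using braid_induction generalizing f with
    | one => simpa using h0 1
    | mul x i h ih =>
      obtain rfl : i = 0 := by omega
      refine ih (fun c => f (c * σ 0 h)) (hf.mul_right _) (fun a => ?_) (fun a b => ?_)
      · simpa using h1 a 1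
      · obtain rfl := braidGroup_one b
        have := hf (addStrand _ a * σ 0 h) 1 0 h
        simp only [mul_one, mul_inv_cancel_right] at this
        simp only [map_one, mul_one]
        rw [this]
        exact S.add_mem (S.smul_mem _ (by simpa using h1 a 1)) (S.smul_mem _ (h0 a))
    | mul_inv x i h ih =>
      obtain rfl : i = 0 := by omega
      refine ih (fun c => f (c * (σ 0 h)⁻¹)) (hf.mul_right _) (fun a => ?_) (fun a b => ?_)
      · have := hf.inv_mem hv S (addStrand _ a) 1 0 h (by simpa using h0 a)
          (by simpa using h1 a 1)
        simpa using this
      · obtain rfl := braidGroup_one b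
        simpa using h0 a
  | succ n IH =>
    intro f hf h0 h1 β
    have key : ∀ (f : BraidGroup (n + 3) → A), IsSkein v z f →
      (∀ a : BraidGroup (n + 2), f (addStrand _ a) ∈ S) →
      (∀ a b : BraidGroup (n + 2),
        f (addStrand _ a * σ (n + 1) (Nat.lt_succ_self _) * addStrand _ b) ∈ S) →
      ∀ a b : BraidGroup (n + 2),
        f (addStrand _ a * σ (n + 1) (Nat.lt_succ_self _) * addStrand _ b *
          σ (n + 1) (Nat.lt_succ_self _)) ∈ S := by
      intro f hf h0 h1 a b
      refine IH (fun b => f (addStrand _ a * σ (n + 1) (Nat.lt_succ_self _) * addStrand _ b *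
          σ (n + 1) (Nat.lt_succ_self _))) (hf.addStrand _ _) (fun c => ?_) (fun c d => ?_) b
      · have e : addStrand _ a * σ (n + 1) (Nat.lt_succ_self _) * addStrand _ (addStrand _ c) *
          σ (n + 1) (Nat.lt_succ_self _) = addStrand _ (a * addStrand _ c) *
            σ (n + 1) (Nat.lt_succ_self _) * σ (n + 1) (Nat.lt_succ_self _) * 1 := by
          rw [mul_assoc (addStrand _ a), (σ_comm_addStrand c).eq]
          simp [mul_assoc]
        rw [e, hf]
        refine S.add_mem (S.smul_mem _ ?_) (S.smul_mem _ ?_)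
        · simpa using h1 (a * addStrand _ c) 1
        · simpa using h0 (a * addStrand _ c)
      · have e : addStrand _ a * σ (n + 1) (Nat.lt_succ_self _) *
            addStrand _ (addStrand _ c * σ n (Nat.lt_succ_self _) * addStrand _ d) *
            σ (n + 1) (Nat.lt_succ_self _) =
            addStrand _ (a * addStrand _ c * σ n (Nat.lt_succ_self _)) *
            σ (n + 1) (Nat.lt_succ_self _) *
            addStrand _ (σ n (Nat.lt_succ_self _) * addStrand _ d) := by
          simp only [map_mul, addStrand_σ, mul_assoc]
          rw [← (σ_comm_addStrand d).eq]
          simp only [← mul_assoc]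
          rw [mul_assoc (addStrand _ a) (σ (n + 1) _), (σ_comm_addStrand c).eq]
          have := σ_braid (n := n + 3) (i := n) (by omega) (by omega)
          simp only [mul_assoc] at this ⊢
          have t := congrArg (fun y => addStrand _ a * (addStrand _ (addStrand _ c) *
            (y * addStrand _ (addStrand _ d)))) this
          simp only [mul_assoc] at t
          exact t.symm
        simp only [e]
        exact h1 _ _
    induction β using braid_induction generalizing f with
    | one => simpa using h0 1
    | mul x i h ih =>
      refine ih (fun c => f (c * σ i h)) (hf.mul_right _) (fun a => ?_) (fun a b => ?_)
      · by_cases hi : i = n + 1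
        · subst hi; simpa using h1 a 1
        · have := h0 (a * σ i (by omega))
          rwa [map_mul, addStrand_σ] at this
      · by_cases hi : i = n + 1
        · subst hi; exact key f hf h0 h1 a b
        · have := h1 a (b * σ i (by omega))
          rwa [map_mul, addStrand_σ, ← mul_assoc] at this
    | mul_inv x i h ih =>
      refine ih (fun c => f (c * (σ i h)⁻¹)) (hf.mul_right _) (fun a => ?_) (fun a b => ?_)
      · have := hf.inv_mem hv S (addStrand _ a) 1 i h (by simpa using h0 a) (by
          by_cases hi : i = n + 1
          · subst hi; simpa using h1 a 1
          · have := h0 (a * σ i (by omega))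
            rw [map_mul, addStrand_σ] at this
            simpa using this)
        simpa using this
      · have := hf.inv_mem hv S (addStrand _ a * σ (n + 1) (Nat.lt_succ_self _) * addStrand _ b)
          1 i h (by simpa using h1 a b) (by
          by_cases hi : i = n + 1
          · subst hi; simpa using key f hf h0 h1 a b
          · have := h1 a (b * σ i (by omega))
            rw [map_mul, addStrand_σ, ← mul_assoc] at this
            simpa using this)
        simpa using this

theorem IsHomfly.isSkein {v z : R} {f : (m : ℕ) → BraidGroup (m + 1) → A}
    (hf : IsHomfly (algebraMap R A v) (algebraMap R A z) f) (m : ℕ) : IsSkein v z (f m) := by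
  intro a b i h
  rw [hf.comm, ← mul_assoc, hf.skein, hf.comm a b, hf.comm _ b, ← mul_assoc,
    Algebra.smul_def, Algebra.smul_def, map_mul, map_pow]

/-- The values are determined in the ring that contains `v`, `z` and their inverses. -/
theorem IsHomfly.mem_range {v z : R} (hv : IsUnit v) (hz : IsUnit z)
    {f : (m : ℕ) → BraidGroup (m + 1) → A}
    (hf : IsHomfly (algebraMap R A v) (algebraMap R A z) f) (m : ℕ) :
    ∀ β, f m β ∈ LinearMap.range (Algebra.linearMap R A) := by
  induction m with
  | zero =>
    intro β
    rw [braidGroup_one β, hf.one]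
    exact ⟨1, by simp⟩
  | succ m ih =>
    refine skein_span hv _ m _ (hf.isSkein _) (fun a => ?_) (fun a b => ?_)
    · have h := hf.skein (addStrand _ a) m (Nat.lt_succ_self _)
      rw [hf.stab, hf.stabNeg, ← map_mul, ← map_pow, ← Algebra.smul_def, ← Algebra.smul_def] at h
      refine (Submodule.smul_mem_iff_of_isUnit _ (hv.mul hz)).1 ?_
      rw [← sub_eq_iff_eq_add.2 h]
      exact Submodule.sub_mem _ (ih a) (Submodule.smul_mem _ _ (ih a))
    · rw [hf.comm, ← mul_assoc, ← map_mul, hf.stab]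
      exact ih _

theorem IsHomfly.unique {v z : R} (hv : IsUnit v) (hz : IsUnit z)
    {f g : (m : ℕ) → BraidGroup (m + 1) → R} (hf : IsHomfly v z f) (hg : IsHomfly v z g)
    (m : ℕ) (β : BraidGroup (m + 1)) : f m β = g m β := by
  have hfg : IsHomfly (algebraMap R (R × R) v) (algebraMap R (R × R) z)
      (fun m β => (f m β, g m β)) := by
    constructor
    · simp [hf.one, hg.one]
    · intro m α β; simp [hf.comm α β, hg.comm α β]
    · intro m β; simp [hf.stab, hg.stab]
    · intro m β; simp [hf.stabNeg, hg.stabNeg]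
    · intro m β i h; simp [hf.skein β i h, hg.skein β i h]
  obtain ⟨r, hr⟩ := hfg.mem_range hv hz m β
  simp only [Algebra.linearMap_apply, Prod.algebraMap_apply, Algebra.algebraMap_self, RingHom.id_apply,
    Prod.mk.injEq] at hr
  rw [← hr.1, ← hr.2]

end Reduction

section VertexModel

variable {ι : Type} [DecidableEq ι] {N : ℕ} (q : ℝ)

/-- The `R`-matrix of the vertex model, acting on the tensor factors `x` and `y`. -/
def Rop (N : ℕ) (x y : ι) : Module.End ℝ ((ι → Fin N) → ℝ) where
  toFun f c := if c x = c y then q * f c else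
    f (c ∘ Equiv.swap x y) + if c x < c y then (q - q⁻¹) * f c else 0
  map_add' f g := by
    ext c; simp only [Pi.add_apply]; split_ifs <;> ring
  map_smul' r f := by
    ext c; simp only [Pi.smul_apply, smul_eq_mul, RingHom.id_apply]; split_ifs <;> ring

theorem Rop_apply (x y : ι) (f : (ι → Fin N) → ℝ) (c : ι → Fin N) :
    Rop q N x y f c = if c x = c y then q * f c else
    f (c ∘ Equiv.swap x y) + if c x < c y then (q - q⁻¹) * f c else 0 := rfl

theorem Rop_sq (hq : q ≠ 0) (x y : ι) :
    Rop q N x y * Rop q N x y = (q - q⁻¹) • Rop q N x y + 1 := by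
  ext f c
  have hs : (c ∘ Equiv.swap x y) ∘ Equiv.swap x y = c := by ext; simp
  simp only [Module.End.mul_apply, LinearMap.add_apply, LinearMap.smul_apply, Pi.add_apply,
    Pi.smul_apply, Module.End.one_apply, smul_eq_mul, Rop_apply, Function.comp_apply,
    Equiv.swap_apply_left, Equiv.swap_apply_right, hs]
  rcases lt_trichotomy (c x) (c y) with h | h | h
  · simp [h, h.ne, h.ne', h.not_gt]; ring
  · simp [h]; field_simp; ring
  · simp [h, h.ne, h.ne', h.not_gt]; ring

/-- The `R`-matrix as an invertible operator. -/
def Runit (N : ℕ) (hq : q ≠ 0) (x y : ι) : (Module.End ℝ ((ι → Fin N) → ℝ))ˣ where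
  val := Rop q N x y
  inv := Rop q N x y - (q - q⁻¹) • 1
  val_inv := by rw [mul_sub, Rop_sq q hq]; simp
  inv_val := by rw [sub_mul, Rop_sq q hq]; simp

theorem Rop_far {x y u w : ι} (hxu : x ≠ u) (hxw : x ≠ w) (hyu : y ≠ u) (hyw : y ≠ w) :
    Rop q N x y * Rop q N u w = Rop q N u w * Rop q N x y := by
  ext f c
  have hs : (c ∘ Equiv.swap x y) ∘ Equiv.swap u w = (c ∘ Equiv.swap u w) ∘ Equiv.swap x y := by
    ext t; simp only [Function.comp_apply, Equiv.swap_apply_def]; split_ifs <;> simp_all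
  simp only [Module.End.mul_apply, Rop_apply, Function.comp_apply,
    Equiv.swap_apply_of_ne_of_ne hxu hxw, Equiv.swap_apply_of_ne_of_ne hyu hyw,
    Equiv.swap_apply_of_ne_of_ne hxu.symm hyu.symm,
    Equiv.swap_apply_of_ne_of_ne hxw.symm hyw.symm, hs]
  split_ifs <;> ring

set_option maxHeartbeats 1000000 in
theorem Rop_braid (hq : q ≠ 0) {x y w : ι} (hxy : x ≠ y) (hxw : x ≠ w) (hyw : y ≠ w) :
    Rop q N x y * Rop q N y w * Rop q N x y = Rop q N y w * Rop q N x y * Rop q N y w := by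
  ext f c
  have e1 : (c ∘ Equiv.swap x y) ∘ Equiv.swap x y = c := by ext; simp
  have e2 : (c ∘ Equiv.swap y w) ∘ Equiv.swap y w = c := by ext; simp
  have e3 : ((c ∘ Equiv.swap x y) ∘ Equiv.swap y w) ∘ Equiv.swap x y =
      ((c ∘ Equiv.swap y w) ∘ Equiv.swap x y) ∘ Equiv.swap y w := by
    ext t; simp only [Function.comp_apply, Equiv.swap_apply_def]; split_ifs <;> simp_all
  have a1 : Equiv.swap x y w = w := Equiv.swap_apply_of_ne_of_ne hxw.symm hyw.symm
  have a2 : Equiv.swap y w x = x := Equiv.swap_apply_of_ne_of_ne hxy hxw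
  simp only [Module.End.mul_apply, Rop_apply, Function.comp_apply,
    Equiv.swap_apply_left, Equiv.swap_apply_right, a1, a2, e1, e2, e3]
  clear e1 e2 e3 a1 a2 hxy hxw hyw
  generalize f (((c ∘ Equiv.swap y w) ∘ Equiv.swap x y) ∘ Equiv.swap y w) = F1
  generalize f ((c ∘ Equiv.swap y w) ∘ Equiv.swap x y) = F2
  generalize f ((c ∘ Equiv.swap x y) ∘ Equiv.swap y w) = F3
  generalize f (c ∘ Equiv.swap x y) = F4
  generalize f (c ∘ Equiv.swap y w) = F5
  generalize f c = F6
  generalize c x = X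
  generalize c y = Y
  generalize c w = W
  rcases lt_trichotomy X Y with h | h | h <;>
  rcases lt_trichotomy Y W with h' | h' | h' <;>
  rcases lt_trichotomy X W with h'' | h'' | h'' <;>
  first
  | (exfalso; omega)
  | (subst_vars
     simp_all [ne_of_lt, ne_of_gt, not_lt_of_gt] <;>
     first
     | (ring; done)
     | (field_simp; ring))

variable (hq : q ≠ 0)

/-- The action of the braid group on the states of the vertex model. -/
def rep (N : ℕ) (n : ℕ) : BraidGroup n →* (Module.End ℝ ((Fin n → Fin N) → ℝ))ˣ :=
  liftHom (fun i => Runit q N hq ⟨i.1, Nat.lt_of_succ_lt i.2⟩ ⟨i.1 + 1, i.2⟩)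
    (by
      rintro ⟨i, hi⟩ ⟨j, hj⟩ h
      simp only at h
      ext1
      apply Rop_far <;> simp only [ne_eq, Fin.mk.injEq] <;> omega)
    (by
      rintro ⟨i, hi⟩ ⟨j, hj⟩ h
      obtain rfl : i + 1 = j := h
      ext1
      apply Rop_braid _ hq <;> simp only [ne_eq, Fin.mk.injEq] <;> omega)

theorem rep_σ {n : ℕ} (i : ℕ) (h : i + 1 < n) :
    rep q hq N n (σ i h) = Runit q N hq ⟨i, Nat.lt_of_succ_lt h⟩ ⟨i + 1, h⟩ :=
  liftHom_σ _ _ _ i h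

theorem rep_σ_inv {n : ℕ} (i : ℕ) (h : i + 1 < n) :
    (((rep q hq N n (σ i h))⁻¹ : (Module.End ℝ ((Fin n → Fin N) → ℝ))ˣ) :
      Module.End ℝ ((Fin n → Fin N) → ℝ)) =
    (rep q hq N n (σ i h) : Module.End ℝ ((Fin n → Fin N) → ℝ)) - (q - q⁻¹) • 1 := by
  rw [rep_σ]; rfl

/-- The weight of a spin. -/
def mu (N : ℕ) (j : ℕ) : ℝ := q ^ (2 * j) * (q * (q ^ N)⁻¹)

/-- The weight of a state. -/
def wt {n : ℕ} (c : Fin n → Fin N) : ℝ := ∏ x, mu q N (c x)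

/-- Multiplication by the weight. -/
def Dop (N n : ℕ) : Module.End ℝ ((Fin n → Fin N) → ℝ) where
  toFun f c := wt q c * f c
  map_add' f g := by ext c; simp [mul_add]
  map_smul' r f := by ext c; simp [mul_left_comm]

theorem Dop_comm_Rop {n : ℕ} (x y : Fin n) :
    Commute (Dop q N n) (Rop q N x y) := by
  refine LinearMap.ext fun f => funext fun c => ?_
  have : wt q (c ∘ Equiv.swap x y) = wt q c :=
    Equiv.prod_comp (Equiv.swap x y) (fun t => mu q N (c t))
  simp only [Module.End.mul_apply, Rop_apply, Dop, LinearMap.coe_mk, AddHom.coe_mk, this]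
  split_ifs <;> ring

theorem Dop_comm {n : ℕ} (β : BraidGroup n) :
    Commute (Dop q N n) (rep q hq N n β : Module.End ℝ ((Fin n → Fin N) → ℝ)) := by
  have hR : ∀ i h, Commute (Dop q N n)
      (rep q hq N n (σ i h) : Module.End ℝ ((Fin n → Fin N) → ℝ)) := by
    intro i h
    rw [rep_σ]
    exact Dop_comm_Rop q _ _
  induction β using braid_induction with
  | one => simp
  | mul x i h ih =>
    rw [map_mul, Units.val_mul]
    exact ih.mul_right (hR i h)
  | mul_inv x i h ih =>
    rw [map_mul, map_inv, Units.val_mul]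
    exact ih.mul_right (hR i h).units_inv_right

/-- The weighted trace. -/
def wtr (N n : ℕ) (S : Module.End ℝ ((Fin n → Fin N) → ℝ)) : ℝ :=
  LinearMap.trace ℝ _ (Dop q N n * S)

theorem wtr_eq {n : ℕ} (S : Module.End ℝ ((Fin n → Fin N) → ℝ)) :
    wtr q N n S = ∑ c, wt q c * S (Pi.single c 1) c := by
  rw [wtr, LinearMap.trace_eq_matrix_trace ℝ (Pi.basisFun ℝ (Fin n → Fin N)), Matrix.trace]
  refine Finset.sum_congr rfl fun c _ => ?_
  simp [Dop]

theorem wtr_add {n : ℕ} (S S' : Module.End ℝ ((Fin n → Fin N) → ℝ)) :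
    wtr q N n (S + S') = wtr q N n S + wtr q N n S' := by
  simp [wtr, mul_add]

theorem wtr_smul {n : ℕ} (r : ℝ) (S : Module.End ℝ ((Fin n → Fin N) → ℝ)) :
    wtr q N n (r • S) = r * wtr q N n S := by
  simp [wtr]

theorem wtr_comm {n : ℕ} (α β : BraidGroup n) :
    wtr q N n (rep q hq N n (α * β)) = wtr q N n (rep q hq N n (β * α)) := by
  rw [map_mul, map_mul, Units.val_mul, Units.val_mul, wtr, wtr, ← mul_assoc,
    LinearMap.trace_mul_comm, ← mul_assoc, ← (Dop_comm q hq β).eq, mul_assoc]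

/-- Fixing the state of the last strand. -/
def restr (N n : ℕ) (a : Fin N) :
    ((Fin (n + 1) → Fin N) → ℝ) →ₗ[ℝ] ((Fin n → Fin N) → ℝ) where
  toFun f c := f (Fin.snoc (α := fun _ => Fin N) c a)
  map_add' _ _ := rfl
  map_smul' _ _ := rfl

theorem restr_apply {n : ℕ} (a : Fin N) (f : (Fin (n + 1) → Fin N) → ℝ) (c : Fin n → Fin N) :
    restr N n a f c = f (Fin.snoc (α := fun _ => Fin N) c a) := rfl

theorem snoc_comp_swap {n : ℕ} (c : Fin n → Fin N) (a : Fin N) (x y : Fin n) :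
    (Fin.snoc (α := fun _ => Fin N) c a) ∘ Equiv.swap x.castSucc y.castSucc =
      Fin.snoc (α := fun _ => Fin N) (c ∘ Equiv.swap x y) a := by
  ext t
  refine Fin.lastCases ?_ (fun t => ?_) t
  · rw [Function.comp_apply, Equiv.swap_apply_of_ne_of_ne (Fin.castSucc_lt_last x).ne'
      (Fin.castSucc_lt_last y).ne']
    simp
  · simp only [Function.comp_apply, Equiv.swap_apply_def, Fin.castSucc_inj, Fin.snoc_castSucc]
    split_ifs <;> simp

theorem restr_Rop {n : ℕ} (a : Fin N) (x y : Fin n) (f : (Fin (n + 1) → Fin N) → ℝ) :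
    restr N n a (Rop q N x.castSucc y.castSucc f) = Rop q N x y (restr N n a f) := by
  ext c
  simp only [restr_apply, Rop_apply, Fin.snoc_castSucc, snoc_comp_swap]

theorem restr_rep {n : ℕ} (a : Fin N) (β : BraidGroup n) (f : (Fin (n + 1) → Fin N) → ℝ) :
    restr N n a ((rep q hq N (n + 1) (addStrand n β) : Module.End ℝ _) f) =
      (rep q hq N n β : Module.End ℝ _) (restr N n a f) := by
  have hR : ∀ (i h) (f : (Fin (n + 1) → Fin N) → ℝ),
      restr N n a ((rep q hq N (n + 1) (σ i (Nat.lt_succ_of_lt h)) : Module.End ℝ _) f) =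
      (rep q hq N n (σ i h) : Module.End ℝ _) (restr N n a f) := by
    intro i h f
    rw [rep_σ, rep_σ]
    exact restr_Rop q a ⟨i, Nat.lt_of_succ_lt h⟩ ⟨i + 1, h⟩ f
  induction β using braid_induction generalizing f with
  | one => simp
  | mul x i h ih =>
    simp only [map_mul, Units.val_mul, Module.End.mul_apply, addStrand_σ]
    rw [ih, hR]
  | mul_inv x i h ih =>
    simp only [map_mul, map_inv, Units.val_mul, Module.End.mul_apply, addStrand_σ]
    rw [ih, rep_σ_inv, rep_σ_inv]
    simp only [LinearMap.sub_apply, map_sub, LinearMap.smul_apply, map_smul,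
      Module.End.one_apply]
    rw [hR i h]

theorem sum_mu (hq : q ≠ 0) (k : ℕ) :
    (q - q⁻¹) * ∑ a ∈ Finset.range k, q ^ (2 * a) * q = q ^ (2 * k) - 1 := by
  induction k with
  | zero => simp
  | succ k ih => rw [Finset.sum_range_succ, mul_add, ih]; field_simp; ring

theorem sum_mu_ite (hq : q ≠ 0) (i k : ℕ) :
    ∑ a ∈ Finset.range k, q ^ (2 * a) * q *
      (if i = a then q else if i < a then q - q⁻¹ else 0) = if i < k then q ^ (2 * k) else 0 := by
  induction k with
  | zero => simp
  | succ k ih =>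
    rw [Finset.sum_range_succ, ih]
    rcases lt_trichotomy i k with h | h | h
    · simp only [h, if_true, h.ne, if_false, Nat.lt_succ_of_lt h]; field_simp; ring
    · subst h; simp; ring
    · have h1 : ¬ i < k := by omega
      have h2 : ¬ i < k + 1 := by omega
      have h3 : ¬ i = k := by omega
      simp [h1, h2, h3]

/-- The total weight of a strand. -/
def total (N : ℕ) : ℝ := ∑ a : Fin N, mu q N a

theorem total_eq (hq : q ≠ 0) (N : ℕ) : (q - q⁻¹) * total q N = q ^ N - (q ^ N)⁻¹ := by
  have h := sum_mu q hq N
  rw [Finset.sum_range] at h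
  have : total q N = (∑ a : Fin N, q ^ (2 * (a : ℕ)) * q) * (q ^ N)⁻¹ := by
    rw [total, Finset.sum_mul]
    exact Finset.sum_congr rfl fun a _ => by rw [mu, mul_assoc]
  rw [this, ← mul_assoc, h]
  field_simp
  ring

theorem strand_sum (hq : q ≠ 0) (i : Fin N) :
    ∑ a : Fin N, mu q N a * (if i = a then q else if i < a then q - q⁻¹ else 0) = q ^ N := by
  have h := sum_mu_ite q hq i N
  rw [Finset.sum_range, if_pos i.2] at h
  have : ∑ a : Fin N, mu q N a * (if i = a then q else if i < a then q - q⁻¹ else 0) =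
      (∑ a : Fin N, q ^ (2 * (a : ℕ)) * q *
      (if (i : ℕ) = a then q else if (i : ℕ) < a then q - q⁻¹ else 0)) * (q ^ N)⁻¹ := by
    rw [Finset.sum_mul]
    refine Finset.sum_congr rfl fun a _ => ?_
    simp only [mu, Fin.ext_iff, Fin.lt_def]
    ring
  rw [this, h]
  field_simp
  ring

theorem wt_snoc {n : ℕ} (c : Fin n → Fin N) (a : Fin N) :
    wt q (Fin.snoc (α := fun _ => Fin N) c a) = wt q c * mu q N a := by
  simp [wt, Fin.prod_univ_castSucc]

theorem wtr_snoc {n : ℕ} (S : Module.End ℝ ((Fin (n + 1) → Fin N) → ℝ)) :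
    wtr q N (n + 1) S = ∑ c : Fin n → Fin N, ∑ a : Fin N, wt q c * mu q N a *
      restr N n a (S (Pi.single (Fin.snoc (α := fun _ => Fin N) c a) 1)) c := by
  rw [wtr_eq, ← (Fin.snocEquiv (fun _ : Fin (n + 1) => Fin N)).sum_comp, Fintype.sum_prod_type_right]
  refine Finset.sum_congr rfl fun c _ => Finset.sum_congr rfl fun a _ => ?_
  have e : (Fin.snocEquiv fun _ : Fin (n + 1) => Fin N) (a, c) =
    Fin.snoc (α := fun _ => Fin N) c a := rfl
  rw [e, wt_snoc, restr_apply]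

theorem snoc_inj {n : ℕ} (c d : Fin n → Fin N) (a b : Fin N) :
    (Fin.snoc (α := fun _ => Fin N) c a : Fin (n + 1) → Fin N) =
      Fin.snoc (α := fun _ => Fin N) d b ↔ c = d ∧ a = b :=
  Fin.snoc_inj

theorem restr_single {n : ℕ} (c : Fin n → Fin N) (a : Fin N) :
    restr N n a (Pi.single (Fin.snoc (α := fun _ => Fin N) c a) 1) = Pi.single c 1 := by
  ext d
  simp only [restr_apply, Pi.single_apply, snoc_inj, and_true]

theorem restr_Rop_last {m : ℕ} (c : Fin (m + 1) → Fin N) (a : Fin N) :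
    restr N (m + 1) a (Rop q N (Fin.castSucc (Fin.last m)) (Fin.last (m + 1))
      (Pi.single (Fin.snoc (α := fun _ => Fin N) c a) 1)) =
    (if c (Fin.last m) = a then q else if c (Fin.last m) < a then q - q⁻¹ else 0) •
      Pi.single c 1 := by
  ext d
  simp only [restr_apply, Rop_apply, Fin.snoc_castSucc, Fin.snoc_last, Pi.smul_apply, smul_eq_mul,
    Pi.single_apply, snoc_inj, and_true]
  by_cases hdc : d = c
  · subst hdc
    by_cases h : d (Fin.last m) = a
    · simp [h]
    · have : ¬ ((Fin.snoc (α := fun _ => Fin N) d a : Fin (m + 2) → Fin N) ∘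
          Equiv.swap (Fin.castSucc (Fin.last m)) (Fin.last (m + 1)) =
          Fin.snoc (α := fun _ => Fin N) d a) := by
        intro e
        have := congrFun e (Fin.last (m + 1))
        simp at this
        exact h this
      simp [h, this]
  · simp only [hdc, if_false, mul_zero, ite_self, add_zero]
    split_ifs with h1 h2
    · rfl
    · exfalso
      have e1 := congrFun h2 (Fin.last (m + 1))
      simp at e1
      exact h1 e1
    · rfl

theorem wtr_stab {m : ℕ} (β : BraidGroup (m + 1)) :
    wtr q N (m + 2) (rep q hq N (m + 2) (addStrand (m + 1) β * σ m (Nat.lt_succ_self _))) =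
      q ^ N * wtr q N (m + 1) (rep q hq N (m + 1) β) := by
  rw [wtr_snoc, wtr_eq, Finset.mul_sum]
  refine Finset.sum_congr rfl fun c _ => ?_
  rw [← strand_sum q hq (c (Fin.last m)), Finset.sum_mul]
  refine Finset.sum_congr rfl fun a _ => ?_
  have hR : (rep q hq N (m + 2) (σ m (Nat.lt_succ_self _)) :
      Module.End ℝ ((Fin (m + 2) → Fin N) → ℝ)) =
      Rop q N (Fin.castSucc (Fin.last m)) (Fin.last (m + 1)) := by
    rw [rep_σ]; rfl
  rw [map_mul, Units.val_mul, Module.End.mul_apply, restr_rep, hR, restr_Rop_last, map_smul, Pi.smul_apply, smul_eq_mul]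
  ring

theorem wtr_addStrand {m : ℕ} (β : BraidGroup (m + 1)) :
    wtr q N (m + 2) (rep q hq N (m + 2) (addStrand (m + 1) β)) =
      total q N * wtr q N (m + 1) (rep q hq N (m + 1) β) := by
  rw [wtr_snoc, wtr_eq, Finset.mul_sum]
  refine Finset.sum_congr rfl fun c _ => ?_
  rw [total, Finset.sum_mul]
  refine Finset.sum_congr rfl fun a _ => ?_
  rw [restr_rep, restr_single]
  ring

theorem wtr_skein {n : ℕ} (β : BraidGroup n) (i : ℕ) (h : i + 1 < n) :
    wtr q N n (rep q hq N n (β * σ i h)) = (q - q⁻¹) * wtr q N n (rep q hq N n β) +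
      wtr q N n (rep q hq N n (β * (σ i h)⁻¹)) := by
  rw [← wtr_smul, ← wtr_add]
  congr 1
  rw [map_mul, map_mul, map_inv, Units.val_mul, Units.val_mul, rep_σ_inv, mul_sub]
  simp

theorem wtr_stabNeg {m : ℕ} (β : BraidGroup (m + 1)) :
    wtr q N (m + 2) (rep q hq N (m + 2) (addStrand (m + 1) β * (σ m (Nat.lt_succ_self _))⁻¹)) =
      (q ^ N)⁻¹ * wtr q N (m + 1) (rep q hq N (m + 1) β) := by
  have h := wtr_skein (N := N) q hq (addStrand (m + 1) β) m (Nat.lt_succ_self _)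
  rw [wtr_stab, wtr_addStrand, ← mul_assoc, total_eq q hq] at h
  linear_combination -h

theorem wtr_one : wtr q N 1 (rep q hq N 1 1) = total q N := by
  rw [wtr_eq, total, ← (Equiv.funUnique (Fin 1) (Fin N)).symm.sum_comp]
  refine Finset.sum_congr rfl fun a _ => ?_
  simp [wt]

theorem total_ne_zero (h1 : 1 < q) (hN : N ≠ 0) : total q N ≠ 0 := by
  intro h
  have hq : q ≠ 0 := by positivity
  have e := total_eq q hq N
  have h2 : 1 < q ^ N := one_lt_pow₀ h1 hN
  have h3 : (q ^ N)⁻¹ < 1 := inv_lt_one_of_one_lt₀ h2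
  rw [h, mul_zero] at e
  linarith

theorem isHomfly_real (h1 : 1 < q) (hN : N ≠ 0) :
    IsHomfly (q ^ N)⁻¹ (q - q⁻¹) (fun m β => (q ^ N)⁻¹ ^ writhe β *
      wtr q N (m + 1) (rep q (by positivity) N (m + 1) β) / total q N) := by
  have hq : q ≠ 0 := by positivity
  have hqN : (q ^ N)⁻¹ ≠ 0 := by positivity
  have ht := total_ne_zero q h1 hN
  constructor
  · simp only [writhe_one, zpow_zero, one_mul]
    exact (congrArg (· / total q N) (wtr_one q hq)).trans (div_self ht)
  · intro m α β
    simp only [wtr_comm q _ α β, writhe_mul, add_comm]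
  · intro m β
    simp only [wtr_stab, writhe_mul, writhe_addStrand, writhe_σ, zpow_add₀ hqN, zpow_one]
    field_simp
  · intro m β
    simp only [wtr_stabNeg, writhe_mul, writhe_inv, writhe_addStrand, writhe_σ, zpow_add₀ hqN,
      zpow_neg_one]
    field_simp
  · intro m β i h
    simp only [wtr_skein q hq β i h, writhe_mul, writhe_inv, writhe_σ, zpow_add₀ hqN,
      zpow_neg_one, zpow_one]
    field_simp

end VertexModel

/-- The parameters of the vertex model. -/
abbrev Param : Type := {p : ℕ × ℝ // p.1 ≠ 0 ∧ 1 < p.2}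

theorem Param.z_ne (p : Param) : p.1.2 - p.1.2⁻¹ ≠ 0 := by
  have h1 := p.2.2
  have h2 : p.1.2⁻¹ < 1 := inv_lt_one_of_one_lt₀ h1
  exact (by linarith : (0 : ℝ) < p.1.2 - p.1.2⁻¹).ne'

theorem Param.v_ne (p : Param) : (p.1.2 ^ p.1.1)⁻¹ ≠ 0 := by
  have h1 := p.2.2
  positivity

/-- Evaluation of Laurent polynomials in `z`. -/
def evalZ (p : Param) : ℤ[T;T⁻¹] →+* ℝ :=
  LaurentPolynomial.eval₂ (Int.castRingHom ℝ) (Units.mk0 _ p.z_ne)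

/-- Evaluation of Laurent polynomials in `v` and `z`. -/
def evalVZ (p : Param) : LaurentVZ →+* ℝ :=
  LaurentPolynomial.eval₂ (evalZ p) (Units.mk0 _ p.v_ne)

/-- Evaluation at all parameters. -/
def evalAll : LaurentVZ →+* (Param → ℝ) := RingHom.pi evalVZ

theorem evalZ_eq_zero (c : ℤ[T;T⁻¹]) (h : ∀ p, evalZ p c = 0) : c = 0 := by
  obtain ⟨n, g, hg⟩ := LaurentPolynomial.exists_T_pow c
  have hroot : ∀ q : ℝ, 1 < q → (g.map (Int.castRingHom ℝ)).IsRoot (q - q⁻¹) := by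
    intro q hq
    have h1 := congrArg (evalZ ⟨(1, q), one_ne_zero, hq⟩) hg
    rw [map_mul, h, zero_mul, evalZ, LaurentPolynomial.eval₂_toLaurent] at h1
    rw [Polynomial.IsRoot, Polynomial.eval_map]
    exact h1
  have hinj : Set.InjOn (fun q : ℝ => q - q⁻¹) (Set.Ioi 1) := by
    intro a ha b hb hab
    simp only [Set.mem_Ioi] at ha hb hab
    rcases lt_trichotomy a b with hlt | hlt | hlt
    · have := inv_strictAnti₀ (by linarith : 0 < a) hlt; linarith
    · exact hlt
    · have := inv_strictAnti₀ (by linarith : 0 < b) hlt; linarith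
  have hinf : Set.Infinite {x | (g.map (Int.castRingHom ℝ)).IsRoot x} := by
    refine ((Set.Ioi_infinite (1 : ℝ)).image hinj).mono ?_
    rintro _ ⟨q, hq, rfl⟩
    exact hroot q hq
  have hg0 : g = 0 := by
    have := Polynomial.eq_zero_of_infinite_isRoot _ hinf
    exact (Polynomial.map_eq_zero_iff (Int.cast_injective)).1 this
  rw [hg0, map_zero] at hg
  exact ((LaurentPolynomial.isUnit_T n).mul_left_eq_zero).1 hg.symm

theorem evalAll_injective : Function.Injective evalAll := by
  rw [injective_iff_map_eq_zero]
  intro c hc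
  have h : ∀ p, evalVZ p c = 0 := fun p => congrFun hc p
  obtain ⟨n, g, hg⟩ := LaurentPolynomial.exists_T_pow c
  have hcoef : ∀ k, g.coeff k = 0 := by
    intro k
    refine evalZ_eq_zero _ fun p => ?_
    have hinf : Set.Infinite {x | (g.map (evalZ p)).IsRoot x} := by
      have hinj : Function.Injective (fun N : ℕ => (p.1.2 ^ (N + 1))⁻¹) := by
        intro a b hab
        have := pow_right_injective₀ (by linarith [p.2.2] : 0 < p.1.2) p.2.2.ne'
          (inv_injective hab)
        omega
      refine (Set.infinite_range_of_injective hinj).mono ?_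
      rintro _ ⟨N, rfl⟩
      have h1 := congrArg (evalVZ ⟨(N + 1, p.1.2), Nat.succ_ne_zero _, p.2.2⟩) hg
      rw [map_mul, h, zero_mul, evalVZ, LaurentPolynomial.eval₂_toLaurent] at h1
      rw [Set.mem_ofPred_eq, Polynomial.IsRoot, Polynomial.eval_map]
      exact h1
    have := congrArg (fun r => Polynomial.coeff r k) (Polynomial.eq_zero_of_infinite_isRoot _ hinf)
    simpa using this
  have hg0 : g = 0 := Polynomial.ext fun k => by simp [hcoef k]
  rw [hg0, map_zero] at hg
  exact ((LaurentPolynomial.isUnit_T n).mul_left_eq_zero).1 hg.symm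

theorem isUnit_vpow (k : ℤ) : IsUnit (vpow k) := LaurentPolynomial.isUnit_T k

theorem isUnit_zvar : IsUnit zvar := (LaurentPolynomial.isUnit_T 1).map _

theorem evalVZ_v (p : Param) : evalVZ p (vpow 1) = (p.1.2 ^ p.1.1)⁻¹ := by
  simp [evalVZ, vpow]

theorem evalVZ_z (p : Param) : evalVZ p zvar = p.1.2 - p.1.2⁻¹ := by
  simp [evalVZ, zvar, evalZ]

theorem exists_isHomfly : ∃ f, IsHomfly (vpow 1) zvar f := by
  let _ : Algebra LaurentVZ (Param → ℝ) := evalAll.toAlgebra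
  let F : (m : ℕ) → BraidGroup (m + 1) → Param → ℝ := fun m β p =>
    (p.1.2 ^ p.1.1)⁻¹ ^ writhe β * wtr p.1.2 p.1.1 (m + 1)
      (rep p.1.2 (by have := p.2.2; positivity) p.1.1 (m + 1) β) / total p.1.2 p.1.1
  have hp : ∀ p : Param, IsHomfly (evalVZ p (vpow 1)) (evalVZ p zvar) (fun m β => F m β p) := by
    intro p
    rw [evalVZ_v, evalVZ_z]
    exact isHomfly_real _ p.2.2 p.2.1
  have hF : IsHomfly (algebraMap LaurentVZ (Param → ℝ) (vpow 1))
      (algebraMap LaurentVZ (Param → ℝ) zvar) F :=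
    { one := funext fun p => (hp p).one
      comm := fun α β => funext fun p => (hp p).comm α β
      stab := fun β => funext fun p => (hp p).stab β
      stabNeg := fun β => funext fun p => (hp p).stabNeg β
      skein := fun β i h => funext fun p => (hp p).skein β i h }
  have hr := fun m β => hF.mem_range (isUnit_vpow 1) isUnit_zvar m β
  choose f hf using hr
  have hf' : ∀ m β, evalAll (f m β) = F m β := hf
  refine ⟨f, ?_, ?_, ?_, ?_, ?_⟩
  · apply evalAll_injective; rw [hf', map_one]; exact hF.one
  · intro m α β; apply evalAll_injective; rw [hf', hf']; exact hF.comm α β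
  · intro m β; apply evalAll_injective; rw [hf', hf']; exact hF.stab β
  · intro m β; apply evalAll_injective; rw [hf', hf']; exact hF.stabNeg β
  · intro m β i h
    apply evalAll_injective
    rw [map_add, map_mul, map_mul, map_mul, map_pow, hf', hf', hf']
    exact hF.skein β i h

theorem vpow_two : vpow 2 = vpow 1 ^ 2 := by
  rw [vpow, vpow, LaurentPolynomial.T_pow]; rfl

theorem IsHomflypt.isHomfly {P : OrientedLink → LaurentVZ} (hP : IsHomflypt P) :
    IsHomfly (vpow 1) zvar (fun _ β => P (braidClosure β)) where
  one := hP.unknot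
  comm := by
    intro m α β
    have := Quot.sound (MarkovMove.conj α (β * α))
    rw [← mul_assoc, mul_inv_cancel_right] at this
    exact (congrArg P this).symm
  stab := fun β => (congrArg P (Quot.sound (MarkovMove.stab β))).symm
  stabNeg := fun β => (congrArg P (Quot.sound (MarkovMove.stabNeg β))).symm
  skein := fun β i h => by rw [hP.skein, vpow_two]

/-- The Homflypt polynomial exists and is unique. -/
theorem existsUnique_isHomflypt : ∃! P : OrientedLink → LaurentVZ, IsHomflypt P := by
  obtain ⟨f, hf⟩ := exists_isHomfly
  refine ⟨Quot.lift (fun b => f b.1 b.2) ?_, ⟨hf.one, fun β i h => ?_⟩, fun Q hQ => ?_⟩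
  · rintro _ _ (⟨α, β⟩ | β | β)
    · change f _ β = f _ (α * β * α⁻¹)
      rw [hf.comm, ← mul_assoc, inv_mul_cancel, one_mul]
    · exact (hf.stab β).symm
    · exact (hf.stabNeg β).symm
  · rw [vpow_two]; exact hf.skein β i h
  · funext L
    obtain ⟨⟨m, β⟩, rfl⟩ := Quot.exists_rep L
    exact hQ.isHomfly.unique (isUnit_vpow 1) isUnit_zvar hf m β

/-- The Homflypt polynomial `P_L(v, z)` of an oriented link. -/
def homflypt : OrientedLink → LaurentVZ := existsUnique_isHomflypt.choose

theorem isHomflypt_homflypt : IsHomflypt homflypt := existsUnique_isHomflypt.choose_spec.1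

/-- The Conway polynomial `∇_L(z) = P_L(1, z)`. -/
def conway (L : OrientedLink) : ℤ[T;T⁻¹] := LaurentPolynomial.eval₂ (RingHom.id _) 1 (homflypt L)

end BraidLink

end

open BraidLink

namespace BraidLink

/-! ### Skein class functions on `B_3` -/

section SkeinTrace

variable {R A : Type} [CommRing R] [CommRing A] [Algebra R A]

/-! Let `D(β)` be the left side minus the right side, a function on `B_3`. Two facts force `D = 0`.

First, `D` is a class function that satisfies the Homflypt skein relation in any place of a word.
For `P` of the closure this is the definition. The other two terms satisfy it because changing or
smoothing one crossing moves the writhe in steps of one. The torus links `T_{w+1}`, `T_w`, `T_{w-1}`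
form a skein triple themselves. The Conway relation `∇₊ = z ∇₀ + ∇₋`, multiplied by `v^(w+1)`,
becomes the Homflypt relation for `v^w ∇`. The factors `P_{O_2}` and `P_{O_3} - 1` do not depend on
`β`.

Second, a skein class function on `B_3` is determined by its values at `1`, `σ_1` and `σ_0 σ_1`, one
for each conjugacy class of the symmetric group `S_3` (a trace on its Hecke algebra). By
`skein_span`, words with at most one `σ_1` suffice. Cyclic rotation brings those with exactly one to
the form `c σ_1` with `c` in `B_2`, and modulo the skein relation `B_2` is spanned by `1` and `σ_0`.
Finally `σ_0` and `σ_1` are conjugate. This is `IsSkein.eq_zero_three`.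

The closures of the three braids are `O_3`, `O_2` and the unknot, with writhes 0, 1 and 2. There `D`
vanishes by `v z P_{O_2} = 1 - v²`, `P_{O_3} = P_{O_2}²`, and the vanishing of the Conway polynomial
on `O_2` and `O_3`. -/

/-- A class function that satisfies the skein relation at the last letter satisfies it in any
place. -/
theorem IsSkein.of_comm {v z : R} {n : ℕ} {f : BraidGroup n → A}
    (comm : ∀ a b, f (a * b) = f (b * a))
    (skein : ∀ (b : BraidGroup n) (i : ℕ) (h : i + 1 < n),
      f (b * σ i h) = (v * z) • f b + (v ^ 2) • f (b * (σ i h)⁻¹)) : IsSkein v z f := by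
  intro a b i h
  -- Cyclic rotation carries the distinguished letter to the end of the word; the smoothed and
  -- inverted words are then rotated back.
  rw [comm, ← mul_assoc, skein, comm b a, mul_assoc, comm b, mul_assoc, ← mul_assoc]

/-- A skein function on `B_2` is determined by its values at `1` and `σ_0`. -/
theorem IsSkein.eq_zero_two {v z : R} (hv : IsUnit v) {f : BraidGroup 2 → A} (hf : IsSkein v z f)
    (h0 : f 1 = 0) (h1 : f (σ 0 Nat.one_lt_two) = 0) (β : BraidGroup 2) : f β = 0 := by
  rw [← Submodule.mem_bot R]
  -- With `S = ⊥`, membership means vanishing. Since `B_1` is trivial, the two spanning families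
  -- reduce to the single braids `1` and `σ_0`.
  refine skein_span hv ⊥ 0 f hf (fun a => ?_) (fun a b => ?_) β
  · rw [braidGroup_one a, map_one, Submodule.mem_bot, h0]
  · rw [braidGroup_one a, braidGroup_one b, map_one, one_mul, mul_one, Submodule.mem_bot, h1]

/-- A skein class function on `B_3` is determined by its values at `1`, `σ_1` and `σ_0 σ_1`. -/
theorem IsSkein.eq_zero_three {v z : R} (hv : IsUnit v) {f : BraidGroup 3 → A}
    (hf : IsSkein v z f) (comm : ∀ a b, f (a * b) = f (b * a)) (h0 : f 1 = 0)
    (h1 : f (σ 1 (by decide)) = 0) (h01 : f (σ 0 (by decide) * σ 1 (by decide)) = 0)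
    (β : BraidGroup 3) : f β = 0 := by
  -- By the braid relation, `σ_0 σ_1` conjugates `σ_0` into `σ_1`.
  have h0' : f (σ 0 (by decide)) = 0 := by
    have e : σ 0 (by decide) * σ 1 (by decide) * σ 0 (by decide) *
        (σ 0 (by decide) * σ 1 (by decide))⁻¹ = (σ 1 (by decide) : BraidGroup 3) := by
      rw [σ_braid, mul_assoc (σ 1 _), mul_inv_cancel_right]
    rwa [← e, mul_assoc, comm, mul_assoc, inv_mul_cancel, mul_one] at h1
  rw [← Submodule.mem_bot R]
  refine skein_span hv ⊥ 1 f hf (fun a => ?_) (fun a b => ?_) β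
  -- Words without `σ_1`: the restriction of `f` to `B_2` is again a skein function.
  · rw [Submodule.mem_bot]
    refine IsSkein.eq_zero_two (z := z) hv (f := fun c => f (BraidLink.addStrand 2 c)) ?_ ?_ ?_ a
    · simpa using hf.addStrand 1 1
    · simpa using h0
    · simpa [addStrand_σ] using h0'
  -- Words `a σ_1 b`: rotation gives `(b a) σ_1`, so only the skein function `c ↦ f (c σ_1)` on
  -- `B_2` has to vanish.
  · rw [Submodule.mem_bot, comm, ← mul_assoc, ← map_mul]
    refine IsSkein.eq_zero_two (z := z) hv
      (f := fun c => f (BraidLink.addStrand 2 c * σ 1 (by decide))) ?_ ?_ ?_ (b * a)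
    · simpa using hf.addStrand 1 (σ 1 (by decide))
    · simpa using h1
    · simpa [addStrand_σ] using h01

end SkeinTrace

/-! ### Values of the Homflypt and Conway polynomials -/

theorem vpow_add (k l : ℤ) : vpow (k + l) = vpow k * vpow l := LaurentPolynomial.T_add k l

theorem isHomfly_homflypt :
    IsHomfly (vpow 1) zvar (fun m (β : BraidGroup (m + 1)) => homflypt (braidClosure β)) :=
  isHomflypt_homflypt.isHomfly

theorem homflypt_σ_zero :
    homflypt (braidClosure (m := 1) (σ 0 Nat.one_lt_two)) = 1 := by
  have := isHomfly_homflypt.stab (m := 0) 1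
  rw [map_one, one_mul] at this
  exact this.trans isHomfly_homflypt.one

/-- The braid is the positive stabilization of the trivial 2-braid. -/
theorem homflypt_σ_one :
    homflypt (braidClosure (m := 2) (σ 1 (by decide))) = homflypt (unlink 2) := by
  have := isHomfly_homflypt.stab (m := 1) 1
  rw [map_one, one_mul] at this
  exact this

/-- The trivial 1-braid, stabilized twice. -/
theorem homflypt_σ_zero_mul_σ_one :
    homflypt (braidClosure (m := 2) (σ 0 (by decide) * σ 1 (by decide))) = 1 := by
  have := isHomfly_homflypt.stab (m := 1) (σ 0 Nat.one_lt_two)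
  rw [addStrand_σ] at this
  exact this.trans homflypt_σ_zero

/-- Adding a split unknot to a braid closure. -/
theorem homflypt_addStrand {m : ℕ} (β : BraidGroup (m + 1)) :
    vpow 1 * zvar * homflypt (braidClosure (addStrand (m + 1) β)) =
      (1 - vpow 1 ^ 2) * homflypt (braidClosure β) := by
  -- In the skein triple at a crossing with the new strand, both crossed diagrams are stabilizations
  -- of `β`, and the smoothed one is `β` with a split unknot.
  have h := isHomfly_homflypt.skein (addStrand (m + 1) β) m (Nat.lt_succ_self _)
  rw [isHomfly_homflypt.stab, isHomfly_homflypt.stabNeg] at h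
  linear_combination -h

theorem homflypt_unlink_two : vpow 1 * zvar * homflypt (unlink 2) = 1 - vpow 1 ^ 2 := by
  have h := homflypt_addStrand (m := 0) 1
  rw [map_one] at h
  exact h.trans (by rw [show homflypt (braidClosure (m := 0) 1) = 1 from isHomfly_homflypt.one,
    mul_one])

theorem homflypt_unlink_three : homflypt (unlink 3) = homflypt (unlink 2) ^ 2 := by
  have h : vpow 1 * zvar * homflypt (unlink 3) = (1 - vpow 1 ^ 2) * homflypt (unlink 2) := by
    have h := homflypt_addStrand (m := 1) 1
    rw [map_one] at h
    exact h
  -- Since `v z` is a unit, it is enough to compare multiples by it; then `1 - v²` is replaced by `v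
  -- z P_{O_2}`.
  refine ((isUnit_vpow 1).mul isUnit_zvar).mul_left_cancel ?_
  rw [h, ← homflypt_unlink_two]
  ring

theorem homflypt_torusLink_add_one (p : ℤ) :
    homflypt (torusLink (p + 1)) = vpow 1 * zvar * homflypt (torusLink p) +
      vpow 1 ^ 2 * homflypt (torusLink (p - 1)) := by
  have h := isHomfly_homflypt.skein (m := 1) (σ 0 Nat.one_lt_two ^ p) 0 Nat.one_lt_two
  rw [← zpow_add_one, ← zpow_sub_one] at h
  exact h

theorem homflypt_torusLink_zero : homflypt (torusLink 0) = homflypt (unlink 2) := by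
  rw [torusLink, zpow_zero]; rfl

theorem homflypt_torusLink_one : homflypt (torusLink 1) = 1 := by
  rw [torusLink, zpow_one, homflypt_σ_zero]

/-- The substitution `v = 1`. -/
noncomputable def evalVOne : LaurentVZ →+* ℤ[T;T⁻¹] := LaurentPolynomial.eval₂ (RingHom.id _) 1

theorem conway_eq (L : OrientedLink) : conway L = evalVOne (homflypt L) := rfl

theorem evalVOne_vpow (k : ℤ) : evalVOne (vpow k) = 1 := by
  simp [evalVOne, vpow]

theorem evalVOne_zvar : evalVOne zvar = LaurentPolynomial.T 1 := by
  simp [evalVOne, zvar]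

theorem conway_skein {m : ℕ} (β : BraidGroup (m + 1)) (i : ℕ) (h : i + 1 < m + 1) :
    conway (braidClosure (β * σ i h)) = LaurentPolynomial.T 1 * conway (braidClosure β) +
      conway (braidClosure (β * (σ i h)⁻¹)) := by
  simp only [conway_eq, isHomflypt_homflypt.skein, map_add, map_mul, evalVOne_vpow,
    evalVOne_zvar, one_mul]

/-- At `v = 1` the relation `v z P_{O_2} = 1 - v²` becomes `z ∇ = 0`, and `z` is a unit. -/
theorem conway_unlink_two : conway (unlink 2) = 0 := by
  have h := congrArg evalVOne homflypt_unlink_two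
  simp only [map_mul, map_sub, map_pow, map_one, evalVOne_vpow, evalVOne_zvar, one_pow, one_mul,
    sub_self] at h
  exact (LaurentPolynomial.isUnit_T 1).mul_right_eq_zero.1 h

theorem conway_unlink_three : conway (unlink 3) = 0 := by
  rw [conway_eq, homflypt_unlink_three, map_pow, ← conway_eq, conway_unlink_two,
    zero_pow two_ne_zero]

/-! ### The difference of the two sides -/

/-- The difference between the Homflypt polynomial of the closure of a 3-braid and its expression
by the Conway polynomial and the writhe. -/
noncomputable def threeBraidDefect (β : BraidGroup 3) : LaurentVZ :=
  homflypt (braidClosure β) -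
    (homflypt (torusLink (writhe β)) * homflypt (unlink 2) -
      LaurentPolynomial.C (conway (braidClosure β)) * vpow (writhe β) *
        (homflypt (unlink 3) - 1))

theorem threeBraidDefect_comm (a b : BraidGroup 3) :
    threeBraidDefect (a * b) = threeBraidDefect (b * a) := by
  have h : homflypt (braidClosure (a * b)) = homflypt (braidClosure (b * a)) :=
    isHomfly_homflypt.comm a b
  simp only [threeBraidDefect, conway_eq, h, writhe_mul, add_comm]

theorem isSkein_threeBraidDefect : IsSkein (vpow 1) zvar threeBraidDefect := by
  refine IsSkein.of_comm threeBraidDefect_comm fun b i h => ?_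
  have h1 := isHomfly_homflypt.skein b i h
  have h2 := homflypt_torusLink_add_one (writhe b)
  have h3 := congrArg LaurentPolynomial.C (conway_skein b i h)
  -- All powers of `v` are expressed through `v^(w-1)`, the one that belongs to the negative
  -- crossing; the skein relation for `v^w ∇` is then a polynomial identity.
  have h4 : vpow (writhe b + 1) = vpow 1 ^ 2 * vpow (writhe b - 1) := by
    rw [← vpow_two, ← vpow_add]; congr 1; ring
  have h5 : vpow (writhe b) = vpow 1 * vpow (writhe b - 1) := by
    rw [← vpow_add]; congr 1; ring
  rw [map_add, map_mul, ← zvar] at h3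
  simp only [threeBraidDefect, writhe_mul, writhe_inv, writhe_σ, smul_eq_mul, ← sub_eq_add_neg,
    h1, h2, h3, h4, h5]
  ring

theorem threeBraidDefect_eq_zero (β : BraidGroup 3) : threeBraidDefect β = 0 := by
  refine isSkein_threeBraidDefect.eq_zero_three (isUnit_vpow 1) threeBraidDefect_comm ?_ ?_ ?_ β
  -- Closure `O_3`: here `T_0 = O_2`, and the Conway term vanishes.
  · rw [threeBraidDefect, writhe_one, homflypt_torusLink_zero,
      show braidClosure (m := 2) 1 = unlink 3 from rfl, conway_unlink_three, homflypt_unlink_three,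
      map_zero]
    ring
  -- Closure `O_2`: here `T_1` is the unknot, and the Conway term vanishes.
  · rw [threeBraidDefect, writhe_σ, homflypt_torusLink_one, conway_eq, homflypt_σ_one,
      ← conway_eq, conway_unlink_two, map_zero]
    ring
  -- Closure the unknot, so `∇ = 1`. With `P_{T_2} = v z + v² P_{O_2}` the squares of `P_{O_2}`
  -- cancel, leaving `1 - v z P_{O_2} - v² = 0`.
  · have h := homflypt_torusLink_add_one 1
    rw [sub_self, homflypt_torusLink_one, homflypt_torusLink_zero] at h
    rw [threeBraidDefect, writhe_mul, writhe_σ, writhe_σ, h, conway_eq,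
      homflypt_σ_zero_mul_σ_one, map_one, map_one, homflypt_unlink_three,
      show (1 + 1 : ℤ) = 2 from rfl, vpow_two]
    linear_combination -homflypt_unlink_two

end BraidLink

theorem mainTheorem6 (β : BraidGroup 3) :
    homflypt (braidClosure β) =
      homflypt (torusLink (writhe β)) * homflypt (unlink 2) -
        LaurentPolynomial.C (conway (braidClosure β)) * vpow (writhe β) *
          (homflypt (unlink 3) - 1) :=
  sub_eq_zero.1 (threeBraidDefect_eq_zero β)
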